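/- **Notation.** For a group $G$ and a subgroup $S$ let $Is(S)=\{x\in G : x^k\in S \text{ for some integer } k\ge 1\}$, and put $M(G)=Is(G'\cdot Z(G))$, $N(G)=Is(G')\cdot Z(G)$. A tuple $\bar u=(u_1,\dots,u_m)$ of elements of $G$ is a *pseudo-basis* of $G$ of period $\bar e=(e_1,\dots,e_m)$ if the subgroups $K_i=\langle u_i,\dots,u_m\rangle$ form a central series $G=K_1\ge\dots\ge K_m\ge K_{m+1}=1$ and $e_i\in\{1,2,\dots\}\cup\{\infty\}$ is the order of $u_iK_{i+1}$ in $K_i/K_{i+1}$. Each $g\in G$ is then uniquely $g=u_1^{t_1(g)}\cdots u_m^{t_m(g)}$ with $t_k(g)\in\mathbb Z$, and $0\le t_k(g)<e_k$ whenever $e_k<\infty$. The integers $t_k([u_i,u_j])$ and $t_k(u_i^{e_i})$ ($e_i<\infty$) are the structure constants of $\bar u$. **Presentation of $G$.** Let $G$ be a finitely generated nilpotent group with a pseudo-basis $\bar u$ of period $\bar e$, and let $0\le i_0\le i_1\le i_2\le m$ and $n=i_1-i_0$, with $i_1+n\le i_2$, be such that * $K_{i_0+1}=M(G)$, $K_{i_1+1}=N(G)$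 and $K_{i_2+1}=Is(G')$; * $e_i=\infty$ for $i\le i_0$ and for $i_1<i\le i_2$, and $1<e_i<\infty$ for $i_0<i\le i_1$; * $u_i\in Z(G)$ for $i_1<i\le i_2$ (so that $G_0=\langle u_{i_1+1},\dots,u_{i_2}\rangle$ is free abelian and $Z(G)=G_0\oplus(Is(G')\cap Z(G))$); * for $i_0<i\le i_1$ the coordinates of $u_i^{e_i}$ satisfy $t_k(u_i^{e_i})=0$ for all $k\le i_2$ except $t_{i+n}(u_i^{e_i})=1$. **Abelian deformation.** Let $d_k$ ($i_1<k\le i_1+n$) be integers and let $(c_{ik})$ ($i_0<i\le i_1$, $i_1<k\le i_1+n$) be an $n\times n$ matrix of integers with $|\det(c_{ik})|=1$ and $\gcd(d,e)=1$, where $d=\prod_{k=i_1+1}^{i_1+n}d_k$ and $e=\prod_{i=i_0+1}^{i_1}e_i$. A group $H$ is the abelian deformation $\mathrm{Abdef}(G,\bar d,\bar c)$ if it has a pseudo-basis $\bar v=(v_1,\dots,v_m)$ of the same period $\bar e$ such that 1. $[v_i,v_j]=\prod_{k=1}^m v_k^{t_k([u_i,u_j])}$ for all $i,j$; 2. $v_i^{e_i}=\prod_{k=1}^m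 v_k^{t_k(u_i^{e_i})}$ whenever $e_i<\infty$ and not $i_0<i\le i_1$; 3. $v_i^{e_i}=\Bigl(\prod_{k=i_1+1}^{i_1+n}v_k^{d_kc_{ik}}\Bigr)\Bigl(\prod_{k=i_2+1}^{m}v_k^{t_k(u_i^{e_i})}\Bigr)$ for $i_0<i\le i_1$. **Theorem (converse of the Characterization Theorem).** Let $G$ be a finitely generated nilpotent group presented as above and let $H=\mathrm{Abdef}(G,\bar d,\bar c)$ be an abelian deformation of $G$. Then $G\equiv H$, that is, $G$ and $H$ satisfy the same sentences of the first-order language of groups. -/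

import Mathlib

/-! The first-order language of groups. -/

/-- Function symbols of the language of groups: multiplication, inversion, identity. -/
inductive GroupFunc : ℕ → Type
  | mul : GroupFunc 2
  | inv : GroupFunc 1
  | one : GroupFunc 0

/-- The first-order language of groups (no relation symbols besides equality). -/
def groupLanguage : FirstOrder.Language.{0, 0} where
  Functions := GroupFunc
  Relations := fun _ => Empty

/-- Every group is a structure for the language of groups, in the obvious way. -/
instance groupLanguageStructure (G : Type*) [Group G] : groupLanguage.Structure G where
  funMap {_} f x :=
    match f with
    | GroupFunc.mul => x 0 * x 1
    | GroupFunc.inv => (x 0)⁻¹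
    | GroupFunc.one => 1
  RelMap {_} r _ := nomatch r

open scoped commutatorElement

/-! Pseudo-bases of nilpotent groups and their structure constants. -/

/-- The isolator `Is(S)`: all `x` some positive power of which lies in `S`. -/
def isolator {G : Type*} [Group G] (S : Subgroup G) : Set G :=
  {x | ∃ k : ℕ, k ≠ 0 ∧ x ^ k ∈ S}

/-- The subgroup generated by the entries of the tuple `u` whose (zero-based) index is at
least `j`. -/
def tailSubgroup {G : Type*} [Group G] {m : ℕ} (u : Fin m → G) (j : ℕ) : Subgroup G :=
  Subgroup.closure {g | ∃ i : Fin m, j ≤ (i : ℕ) ∧ u i = g}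

/-- The product `u₀ ^ t₀ * u₁ ^ t₁ * ⋯ * uₘ₋₁ ^ tₘ₋₁`, in this order. -/
def ordProd {G : Type*} [Group G] {m : ℕ} (u : Fin m → G) (t : Fin m → ℤ) : G :=
  (List.ofFn fun k => u k ^ t k).prod

/-- `u` is a pseudo-basis of `G` of period `e`: the subgroups `Kⱼ = ⟨uⱼ, …, uₘ₋₁⟩` form a
central series from `G` to `1` (whose quotients `Kᵢ / Kᵢ₊₁` are then cyclic, generated by the
image of `uᵢ`), and `e i` generates the ideal of all `a` in `ℤ` with `uᵢ ^ a ∈ Kᵢ₊₁`.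
Thus `e i` is the order of `uᵢ` modulo `Kᵢ₊₁`, where `e i = 0` encodes an infinite period. -/
structure IsPseudoBasis {G : Type*} [Group G] {m : ℕ} (u : Fin m → G) (e : Fin m → ℕ) :
    Prop where
  generates : tailSubgroup u 0 = ⊤
  central : ∀ j : ℕ, ⁅tailSubgroup u j, (⊤ : Subgroup G)⁆ ≤ tailSubgroup u (j + 1)
  period : ∀ (i : Fin m) (a : ℤ), u i ^ a ∈ tailSubgroup u ((i : ℕ) + 1) ↔ (e i : ℤ) ∣ a

/-- `t` is the coordinate tuple of `g` with respect to the pseudo-basis `u` of period `e`: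
`g = ∏ uₖ ^ tₖ`, where `tₖ` is the least non-negative residue if the period is finite. -/
def IsCoord {G : Type*} [Group G] {m : ℕ} (u : Fin m → G) (e : Fin m → ℕ) (g : G)
    (t : Fin m → ℤ) : Prop :=
  (∀ k, e k ≠ 0 → 0 ≤ t k ∧ t k < (e k : ℤ)) ∧ g = ordProd u t

/-- The lengths of the blocks of an adapted pseudo-basis.  With zero-based indices, the blocks
are `[0, i₀)` for `G / M(G)`, `[i₀, i₁)` for `M(G) / N(G)`, `[i₁, i₂)` for `N(G) / Is(G')` and
`[i₂, m)` for `Is(G')`, where `i₁ = i₀ + n`. -/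
structure Blocks where
  (i₀ n i₂ m : ℕ)
  le_i₂ : i₀ + n + n ≤ i₂
  le_m : i₂ ≤ m

namespace Blocks

/-- `i₁ = i₀ + n`. -/
def i₁ (B : Blocks) : ℕ := B.i₀ + B.n

/-- The `j`-th index of the block `[i₀, i₁)` of `M(G) / N(G)`. -/
def tor (B : Blocks) (j : Fin B.n) : Fin B.m :=
  ⟨B.i₀ + j, by have := B.le_i₂; have := B.le_m; omega⟩

/-- The `l`-th index of the block `[i₁, i₂)` of the addition; `add j = tor j + n`. -/
def add (B : Blocks) (l : Fin B.n) : Fin B.m :=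
  ⟨B.i₀ + B.n + l, by have := B.le_i₂; have := B.le_m; omega⟩

end Blocks

/-- `u` is a pseudo-basis of `G` of period `e` adapted to the series
`G ≥ M(G) ≥ N(G) ≥ Is(G') ≥ 1`, where `M(G) = Is(G' Z(G))` and `N(G) = Is(G') Z(G)`, whose
entries in the block `[i₁, i₂)` are a basis of an addition of `G`, that is, of a subgroup `G₀`
with `Z(G) = G₀ ⊕ (Is(G') ∩ Z(G))`, and are normalised so that modulo `Is(G')` the power
`uᵢ ^ eᵢ` is `uᵢ₊ₙ` for `i` in `[i₀, i₁)`. -/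
structure IsAdaptedPseudoBasis {G : Type*} [Group G] (B : Blocks) (u : Fin B.m → G)
    (e : Fin B.m → ℕ) : Prop extends IsPseudoBasis u e where
  /-- `K` at `i₀` is `M(G)`. -/
  tail_i₀ : (tailSubgroup u B.i₀ : Set G) = isolator (commutator G ⊔ Subgroup.center G)
  /-- `K` at `i₁` is `N(G)`. -/
  tail_i₁ : tailSubgroup u B.i₁ = tailSubgroup u B.i₂ ⊔ Subgroup.center G
  /-- `K` at `i₂` is `Is(G')`. -/
  tail_i₂ : (tailSubgroup u B.i₂ : Set G) = isolator (commutator G)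
  /-- The first block is a basis of the free abelian group `G / M(G)`. -/
  period_free : ∀ i : Fin B.m, (i : ℕ) < B.i₀ → e i = 0
  /-- The second block has finite non-trivial periods. -/
  period_tor : ∀ j : Fin B.n, 1 < e (B.tor j)
  /-- The third block is a basis of the free abelian group `N(G) / Is(G')`, -/
  period_add : ∀ i : Fin B.m, B.i₁ ≤ (i : ℕ) → (i : ℕ) < B.i₂ → e i = 0
  /-- and it consists of central elements. -/
  central_add : ∀ i : Fin B.m, B.i₁ ≤ (i : ℕ) → (i : ℕ) < B.i₂ → u i ∈ Subgroup.center G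
  /-- The normalisation of the powers `uᵢ ^ eᵢ` for `i` in `[i₀, i₁)`. -/
  normalised : ∀ j : Fin B.n, ∃ t, IsCoord u e (u (B.tor j) ^ e (B.tor j)) t ∧
    ∀ k : Fin B.m, (k : ℕ) < B.i₂ → t k = if k = B.add j then 1 else 0

/-- The group `H`, with the pseudo-basis `v`, is the abelian deformation `Abdef(G, d, c)` of the
group `G` with the adapted pseudo-basis `u` of period `e`: `v` has the same length, the same
periods and the same structure constants (the coordinates of `[vᵢ, vⱼ]` and of `vᵢ ^ eᵢ`) as
`u`, except that for `i` in `[i₀, i₁)` the factor `uᵢ₊ₙ` of `uᵢ ^ eᵢ` is replaced by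
`∏ vₖ ^ (dₖ cᵢₖ)`, the product being over the indices `k` in `[i₁, i₁ + n)`. -/
structure IsAbelianDeformation {G H : Type*} [Group G] [Group H] (B : Blocks)
    (u : Fin B.m → G) (e : Fin B.m → ℕ) (d : Fin B.n → ℤ)
    (c : Matrix (Fin B.n) (Fin B.n) ℤ) (v : Fin B.m → H) : Prop where
  pseudoBasis : IsPseudoBasis v e
  comm : ∀ i j : Fin B.m, ∃ t, IsCoord u e ⁅u i, u j⁆ t ∧ ⁅v i, v j⁆ = ordProd v t
  pow : ∀ i : Fin B.m, ¬ (B.i₀ ≤ (i : ℕ) ∧ (i : ℕ) < B.i₁) → e i ≠ 0 →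
    ∃ t, IsCoord u e (u i ^ e i) t ∧ v i ^ e i = ordProd v t
  pow_tor : ∀ j : Fin B.n, ∃ t, IsCoord u e (u (B.tor j) ^ e (B.tor j)) t ∧
    v (B.tor j) ^ e (B.tor j) =
      (List.ofFn fun l : Fin B.n => v (B.add l) ^ (d l * c j l)).prod *
        ordProd v fun k => if B.i₂ ≤ (k : ℕ) then t k else 0

/-!
The ultrapowers of `G` and `H` along a non-principal ultrafilter on `ℕ` are isomorphic; by Łoś's
theorem, `G` and `H` are then elementarily equivalent.

Let `V = ℤⁿ` be embedded in the centre of `G` as the span of the generators `u (add l)`, and in the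
centre of `H` as the span of the `v (add l)`.  Let `d'` consist of integers that are congruent to
`d` modulo the product of the periods `e (tor j)`.  There is a homomorphism `φ : G → H` which maps
`u k` to `v k` modulo `V` and acts on `V` by the matrix `c * diagonal d'`: the relations
`v (tor j) ^ e (tor j) = …`, which contain `d` and not `d'`, are repaired by multiplying
`v (tor j)` by a central element whose `e (tor j)`-th power makes up the difference
(`IsAbelianDeformation.exists_hom`, on the basis of von Dyck's theorem `IsPseudoBasis.exists_hom`).
Such a `φ` induces an isomorphism modulo `V`.  Since `d` is prime to the periods, `d'` can be chosen
prime to any given `K`, and then `φ` is also invertible on `V` modulo `K`.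

The homomorphisms obtained for `K = k!`, `k ∈ ℕ`, combine to a homomorphism `Φ` of ultrapowers.  It
is an isomorphism modulo the subgroup `D` of infinitely divisible elements of the ultrapower of `V`,
because every standard integer divides almost all `k!`.  As `V` is torsion-free, `D` is divisible,
and it meets the derived subgroup of the ultrapower of `G` trivially; hence it is a retract of that
ultrapower (`exists_retraction_of_divisible`).  Keeping `Φ` on the kernel of the retraction and
replacing it by the identity on `D` gives an isomorphism (`nonempty_mulEquiv_of_divisible`,
`elementarilyEquivalent_of_homs`).
-/

/-! ### Elementary equivalence from isomorphic ultrapowers -/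

/-- An isomorphism of groups is an isomorphism of structures for the language of groups. -/
def MulEquiv.groupLanguageEquiv {G H : Type*} [Group G] [Group H] (f : G ≃* H) :
    groupLanguage.Equiv G H where
  toEquiv := f.toEquiv
  map_fun' {n} g x := by
    cases g with
    | mul => exact f.map_mul _ _
    | inv => exact f.map_inv _
    | one => exact f.map_one
  map_rel' {n} r := nomatch r

/-- The group of germs along an ultrafilter is the model-theoretic ultrapower. -/
def germEquivProduct (U : Ultrafilter ℕ) (G : Type*) [Group G] :
    groupLanguage.Equiv (Filter.Germ (U : Filter ℕ) G) ((U : Filter ℕ).Product fun _ => G) where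
  toEquiv := Quotient.congr (Equiv.refl _) fun _ _ => Iff.rfl
  map_fun' {n} g x := by
    induction x using Quotient.induction_on_pi with | _ x
    refine Eq.trans ?_ (FirstOrder.Language.Ultraproduct.funMap_cast g x).symm
    cases g <;> rfl
  map_rel' {n} r := nomatch r

theorem elementarilyEquivalent_germ (U : Ultrafilter ℕ) (G : Type*) [Group G] :
    groupLanguage.ElementarilyEquivalent G (Filter.Germ (U : Filter ℕ) G) := by
  refine FirstOrder.Language.ElementarilyEquivalent.trans ?_
    (FirstOrder.Language.StrongHomClass.elementarilyEquivalent (germEquivProduct U G)).symm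
  rw [FirstOrder.Language.elementarilyEquivalent_iff]
  intro φ
  rw [FirstOrder.Language.Ultraproduct.sentence_realize]
  exact Filter.eventually_const.symm

theorem elementarilyEquivalent_of_germ_mulEquiv (U : Ultrafilter ℕ) {G H : Type*} [Group G]
    [Group H] (f : Filter.Germ (U : Filter ℕ) G ≃* Filter.Germ (U : Filter ℕ) H) :
    groupLanguage.ElementarilyEquivalent G H :=
  ((elementarilyEquivalent_germ U G).trans
    (FirstOrder.Language.StrongHomClass.elementarilyEquivalent f.groupLanguageEquiv)).trans
    (elementarilyEquivalent_germ U H).symm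

/-! ### Correcting an embedding along a divisible central subgroup -/

/-- A divisible group `D` mapped to a group `Γ` so that only the identity goes to the derived
subgroup is a retract of `Γ`, because divisible abelian groups are injective. -/
theorem exists_retraction_of_divisible {Γ D : Type*} [Group Γ] [CommGroup D]
    (hD : ∀ M : ℕ, M ≠ 0 → ∀ x : D, ∃ y, y ^ M = x)
    (α : D →* Γ) (hα : ∀ x, α x ∈ commutator Γ → x = 1) :
    ∃ ρ : Γ →* D, ∀ x, ρ (α x) = x := by
  let _ : DivisibleBy (Additive D) ℕ := divisibleByOfSMulRightSurj _ _
    fun {n} hn x => hD n hn x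
  let _ : DivisibleBy (Additive D) ℤ := AddGroup.divisibleByIntOfDivisibleByNat _
  let f : Additive D →+ Additive (Abelianization Γ) := (Abelianization.of.comp α).toAdditive
  have hf : Function.Injective f := by
    rw [injective_iff_map_eq_zero]
    intro x hx
    refine hα x.toMul ?_
    rw [← Abelianization.ker_of]
    exact hx
  obtain ⟨h, hh⟩ := (Module.Baer.of_divisible (Additive D)).extension_property_addMonoidHom f hf
    (AddMonoidHom.id _)
  exact ⟨(AddMonoidHom.toMultiplicative h).comp Abelianization.of, fun x => DFunLike.congr_fun hh x⟩

/-- Let `D` be a divisible group that is central in `Γ` and `Δ` and meets the derived subgroup of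
`Γ` trivially.  If there is a homomorphism `Φ : Γ → Δ` that maps `D` to `D`, not necessarily onto,
and induces an isomorphism modulo `D`, then `Γ` and `Δ` are isomorphic. -/
theorem nonempty_mulEquiv_of_divisible {Γ Δ D : Type*} [Group Γ] [Group Δ] [CommGroup D]
    (hD : ∀ M : ℕ, M ≠ 0 → ∀ x : D, ∃ y, y ^ M = x)
    (α : D →* Γ) (hαc : ∀ x g, α x * g = g * α x) (hα : ∀ x, α x ∈ commutator Γ → x = 1)
    (β : D →* Δ) (hβc : ∀ x h, β x * h = h * β x) (hβ : Function.Injective β)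
    (Φ : Γ →* Δ) (hΦα : ∀ x, ∃ y, Φ (α x) = β y) (hinj : ∀ g y, Φ g = β y → ∃ x, g = α x)
    (hsurj : ∀ h, ∃ g y, h = Φ g * β y) : Nonempty (Γ ≃* Δ) := by
  obtain ⟨ρ, hρ⟩ := exists_retraction_of_divisible hD α hα
  -- Modulo the kernel of the retraction `ρ` the map `Φ` is kept; on `D` it is replaced by `β`.
  let Ψ : Γ →* Δ :=
    { toFun := fun g => Φ (g * α (ρ g)⁻¹) * β (ρ g)
      map_one' := by simp
      map_mul' := by
        intro g h
        have h1 : g * h * α (ρ (g * h))⁻¹ = (g * α (ρ g)⁻¹) * (h * α (ρ h)⁻¹) := by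
          rw [map_mul, mul_inv, map_mul, mul_assoc g (α _), ← mul_assoc (α (ρ g)⁻¹) h,
            hαc (ρ g)⁻¹ h]
          simp only [mul_assoc]
        rw [h1, map_mul Φ, map_mul ρ, map_mul β, mul_assoc (Φ (g * _)) (β _),
          ← mul_assoc (β (ρ g)) (Φ _), hβc (ρ g) (Φ _)]
        simp only [mul_assoc] }
  have hΨ : ∀ g, Ψ g = Φ (g * α (ρ g)⁻¹) * β (ρ g) := fun _ => rfl
  have hker : ∀ g, ρ (g * α (ρ g)⁻¹) = 1 := fun g => by rw [map_mul, hρ, mul_inv_cancel]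
  refine ⟨MulEquiv.ofBijective Ψ ⟨(injective_iff_map_eq_one Ψ).2 fun g hg => ?_, fun h => ?_⟩⟩
  · rw [hΨ, mul_eq_one_iff_eq_inv, ← map_inv β] at hg
    obtain ⟨x, hx⟩ := hinj _ _ hg
    have hx1 : x = 1 := by rw [← hρ x, ← hx, hker]
    rw [hx, hx1, map_one, map_one] at hg
    have hg1 : ρ g = 1 := by
      rw [← inv_eq_one]; exact hβ (by rw [← hg, map_one])
    rwa [hx1, hg1, inv_one, map_one, mul_one] at hx
  · obtain ⟨g, y, rfl⟩ := hsurj h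
    obtain ⟨z, hz⟩ := hΦα (ρ g)
    refine ⟨g * α (ρ g)⁻¹ * α (z * y), ?_⟩
    have h1 : ρ (g * α (ρ g)⁻¹ * α (z * y)) = z * y := by rw [map_mul, hker, hρ, one_mul]
    rw [hΨ, h1, mul_assoc _ (α (z * y)), ← map_mul α, mul_inv_cancel, map_one, mul_one, map_mul,
      map_inv, map_inv, hz, map_mul, mul_assoc, inv_mul_cancel_left]

/-! ### Germs of homomorphisms -/

/-- The homomorphism of germs induced by a sequence of homomorphisms. -/
def germHom (U : Filter ℕ) {M N : Type*} [Group M] [Group N] (f : ℕ → M →* N) :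
    U.Germ M →* U.Germ N where
  toFun := Filter.Germ.map' (fun x k => f k (x k)) fun _ _ h => h.mono fun k hk => by
    simp only [hk]
  map_one' := congrArg _ (funext fun k => map_one (f k))
  map_mul' x y := by
    induction x using Filter.Germ.inductionOn with | _ x
    induction y using Filter.Germ.inductionOn with | _ y
    exact congrArg _ (funext fun k => map_mul (f k) _ _)

theorem germHom_coe (U : Filter ℕ) {M N : Type*} [Group M] [Group N] (f : ℕ → M →* N)
    (x : ℕ → M) : germHom U f (x : U.Germ M) = ((fun k => f k (x k) : ℕ → N) : U.Germ N) :=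
  rfl

/-- A sequence whose germ lies in the derived subgroup lies in the derived subgroup almost
everywhere. -/
theorem eventually_mem_commutator_of_germ (U : Filter ℕ) {G : Type*} [Group G] (x : ℕ → G)
    (hx : (x : U.Germ G) ∈ commutator (U.Germ G)) : ∀ᶠ k in U, x k ∈ commutator G := by
  have h := Abelianization.commutator_subset_ker
    (germHom U fun _ => (Abelianization.of : G →* Abelianization G)) hx
  rw [MonoidHom.mem_ker, germHom_coe] at h
  refine (Filter.Germ.coe_eq.1 h).mono fun k hk => ?_
  rw [← Abelianization.ker_of]
  exact hk

theorem germ_comm {U : Filter ℕ} {V G : Type*} [Group V] [Group G] (a : V →* G)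
    (hac : ∀ x g, a x * g = g * a x) (x : U.Germ V) (g : U.Germ G) :
    germHom U (fun _ => a) x * g = g * germHom U (fun _ => a) x := by
  induction x using Filter.Germ.inductionOn with | _ x
  induction g using Filter.Germ.inductionOn with | _ g
  exact congrArg _ (funext fun k => hac _ _)

/-- The subgroup of a commutative group consisting of the elements that have roots of every
order. -/
def infinitelyDivisible (A : Type*) [CommGroup A] : Subgroup A :=
  ⨅ M : {M : ℕ // M ≠ 0}, (powMonoidHom (M : ℕ)).range

theorem mem_infinitelyDivisible {A : Type*} [CommGroup A] {x : A} :
    x ∈ infinitelyDivisible A ↔ ∀ M : ℕ, M ≠ 0 → ∃ y, y ^ M = x := by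
  simp [infinitelyDivisible, Subgroup.mem_iInf]

/-- In a torsion-free commutative group the roots of infinitely divisible elements are again
infinitely divisible. -/
theorem infinitelyDivisible_divisible {A : Type*} [CommGroup A]
    (hA : ∀ M : ℕ, M ≠ 0 → ∀ x : A, x ^ M = 1 → x = 1) (M : ℕ) (hM : M ≠ 0)
    (x : infinitelyDivisible A) : ∃ y, y ^ M = x := by
  obtain ⟨x, hx⟩ := x
  obtain ⟨y, rfl⟩ := mem_infinitelyDivisible.1 hx M hM
  refine ⟨⟨y, mem_infinitelyDivisible.2 fun N hN => ?_⟩, rfl⟩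
  obtain ⟨z, hz⟩ := mem_infinitelyDivisible.1 hx (N * M) (mul_ne_zero hN hM)
  refine ⟨z, eq_of_div_eq_one (hA M hM _ ?_)⟩
  rw [div_pow, ← pow_mul, hz, div_self']

/-- The germ of `x` is infinitely divisible if and only if, for every `M`, almost all entries of
`x` are `M`-th powers. -/
theorem germ_mem_infinitelyDivisible {U : Filter ℕ} [U.NeBot] {V : Type*} [CommGroup V]
    (x : ℕ → V) :
    (x : U.Germ V) ∈ infinitelyDivisible (U.Germ V) ↔
      ∀ M : ℕ, M ≠ 0 → ∀ᶠ k in U, ∃ y, y ^ M = x k := by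
  rw [mem_infinitelyDivisible]
  refine forall₂_congr fun M hM => ⟨?_, fun h => ?_⟩
  · rintro ⟨y, hy⟩
    induction y using Filter.Germ.inductionOn with | _ y
    exact (Filter.Germ.coe_eq.1 hy).mono fun k hk => ⟨y k, hk⟩
  · obtain ⟨y, hy⟩ := h.choice
    exact ⟨(y : U.Germ V), Filter.Germ.coe_eq.2 hy⟩

/-- A criterion for elementary equivalence.  Let a torsion-free group `V` be embedded in the
centres of `G` and `H`, in such a way that it meets the derived subgroup of `G` trivially.  If for
all `K ≠ 0` there is a homomorphism `φ : G → H` which induces an isomorphism modulo `V` and, on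
`V`, a map that is invertible modulo `K`, then `G` and `H` are elementarily equivalent: the
homomorphisms for `K = k!` combine to one between ultrapowers which is an isomorphism modulo the
infinitely divisible elements of the ultrapower of `V`. -/
theorem elementarilyEquivalent_of_homs {G H V : Type*} [Group G] [Group H] [CommGroup V]
    (hV : ∀ M : ℕ, M ≠ 0 → ∀ x : V, x ^ M = 1 → x = 1)
    (a : V →* G) (hac : ∀ x g, a x * g = g * a x) (ha : ∀ x, a x ∈ commutator G → x = 1)
    (b : V →* H) (hbc : ∀ x h, b x * h = h * b x) (hb : Function.Injective b)
    (hφ : ∀ K : ℕ, K ≠ 0 → ∃ φ : G →* H, ∃ ψ : V →* V, (∀ x, φ (a x) = b (ψ x)) ∧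
      (∀ g y, φ g = b y → ∃ x, g = a x) ∧ (∀ h, ∃ g y, h = φ g * b (y ^ K)) ∧
      ∀ M : ℕ, M ∣ K → ∀ x y, ψ x = y ^ M → ∃ z, z ^ M = x) :
    groupLanguage.ElementarilyEquivalent G H := by
  choose φ ψ hφψ hinj hsurj hdiv using fun k : ℕ => hφ k.factorial k.factorial_ne_zero
  let U : Ultrafilter ℕ := Filter.hyperfilter ℕ
  have hU : ∀ M : ℕ, M ≠ 0 → ∀ᶠ k in (U : Filter ℕ), M ∣ k.factorial := fun M hM =>
    Filter.Eventually.filter_mono (Nat.hyperfilter_le_atTop)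
      ((Filter.eventually_ge_atTop M).mono fun k hk =>
        Nat.dvd_factorial (Nat.pos_of_ne_zero hM) hk)
  let D := infinitelyDivisible (Filter.Germ (U : Filter ℕ) V)
  let α := (germHom (U : Filter ℕ) fun _ => a).comp D.subtype
  let β := (germHom (U : Filter ℕ) fun _ => b).comp D.subtype
  suffices h : Nonempty (Filter.Germ (U : Filter ℕ) G ≃* Filter.Germ (U : Filter ℕ) H) from
    elementarilyEquivalent_of_germ_mulEquiv U h.some
  refine nonempty_mulEquiv_of_divisible (D := D) (infinitelyDivisible_divisible ?_) α
    (fun x => germ_comm a hac _) ?_ β (fun x => germ_comm b hbc _) ?_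
    (germHom (U : Filter ℕ) φ) ?_ ?_ ?_
  · intro M hM x hx
    induction x using Filter.Germ.inductionOn with | _ x
    exact Filter.Germ.coe_eq.2 ((Filter.Germ.coe_eq.1 hx).mono fun k hk => hV M hM _ hk)
  · rintro ⟨x, hx⟩ h
    induction x using Filter.Germ.inductionOn with | _ x
    exact Subtype.ext (Filter.Germ.coe_eq.2
      ((eventually_mem_commutator_of_germ _ _ h).mono fun k hk => ha _ hk))
  · rw [injective_iff_map_eq_one]
    rintro ⟨x, hx⟩ h
    induction x using Filter.Germ.inductionOn with | _ x
    exact Subtype.ext (Filter.Germ.coe_eq.2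
      ((Filter.Germ.coe_eq.1 h).mono fun k hk => hb (hk.trans (map_one b).symm)))
  · rintro ⟨x, hx⟩
    refine ⟨⟨germHom (U : Filter ℕ) ψ x, mem_infinitelyDivisible.2 fun M hM => ?_⟩, ?_⟩
    · obtain ⟨y, rfl⟩ := mem_infinitelyDivisible.1 hx M hM
      exact ⟨germHom _ ψ y, (map_pow _ _ _).symm⟩
    · induction x using Filter.Germ.inductionOn with | _ x
      exact congrArg _ (funext fun k => hφψ k _)
  · rintro g ⟨y, hy⟩ h
    induction g using Filter.Germ.inductionOn with | _ g
    induction y using Filter.Germ.inductionOn with | _ y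
    have h' := Filter.Germ.coe_eq.1 h
    obtain ⟨x, hx⟩ := (h'.mono fun k hk => hinj k _ _ hk).choice
    refine ⟨⟨(x : Filter.Germ (U : Filter ℕ) V), ?_⟩, Filter.Germ.coe_eq.2 hx⟩
    rw [germ_mem_infinitelyDivisible] at hy ⊢
    intro M hM
    filter_upwards [h', hx, hy M hM, hU M hM] with k h1 h2 h3 h4
    obtain ⟨z, hz⟩ := h3
    refine hdiv k M h4 (x k) z (hb ?_)
    rw [← hφψ, ← h2, hz]
    exact h1
  · intro h
    induction h using Filter.Germ.inductionOn with | _ h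
    choose g y hgy using fun k => hsurj k (h k)
    refine ⟨(g : Filter.Germ (U : Filter ℕ) G),
      ⟨((fun k => y k ^ k.factorial : ℕ → V) : Filter.Germ (U : Filter ℕ) V), ?_⟩,
      congrArg _ (funext hgy)⟩
    rw [germ_mem_infinitelyDivisible]
    intro M hM
    refine (hU M hM).mono fun k hk => ?_
    obtain ⟨c, hc⟩ := hk
    exact ⟨y k ^ c, by rw [← pow_mul, mul_comm, hc]⟩

/-! ### Ordered products -/

section OrdProd

variable {G H : Type*} [Group G] [Group H] {m : ℕ}

theorem map_ordProd (f : G →* H) (u : Fin m → G) (t : Fin m → ℤ) :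
    f (ordProd u t) = ordProd (fun k => f (u k)) t := by
  simp only [ordProd, map_list_prod, List.map_ofFn, Function.comp_def, map_zpow]

theorem ordProd_congr {u w : Fin m → G} {s t : Fin m → ℤ} (h : ∀ k, u k ^ s k = w k ^ t k) :
    ordProd u s = ordProd w t := by
  simp only [ordProd, h]

theorem ordProd_zero (u : Fin m → G) : ordProd u (fun _ => 0) = 1 := by
  simp [ordProd]

theorem ordProd_split (u : Fin m → G) (t : Fin m → ℤ) (j : ℕ) :
    ordProd u t = ordProd u (fun k => if (k : ℕ) < j then t k else 0) *
      ordProd u (fun k => if (k : ℕ) < j then 0 else t k) := by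
  induction m generalizing j with
  | zero => simp [ordProd]
  | succ m ih =>
    cases j with
    | zero => simp [ordProd]
    | succ j =>
      have := ih (fun k => u k.succ) (fun k => t k.succ) j
      simp only [ordProd] at this
      simp only [ordProd, List.ofFn_succ, List.prod_cons, this]
      simp [mul_assoc]

theorem ordProd_single (u : Fin m → G) (k : Fin m) (a : ℤ) :
    ordProd u (Pi.single k a) = u k ^ a := by
  induction m with
  | zero => exact k.elim0
  | succ m ih =>
    simp only [ordProd, List.ofFn_succ, List.prod_cons]
    cases k using Fin.cases with
    | zero => simp
    | succ k =>
      have := ih (fun k => u k.succ) k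
      simp only [ordProd] at this
      rw [← this]
      simp [Pi.single_apply]

open scoped IsMulCommutative in
/-- An ordered product of central elements can be computed in the centre. -/
theorem ordProd_eq_prod_center (z : Fin m → Subgroup.center G) (u : Fin m → G) (t : Fin m → ℤ)
    (h : ∀ k, u k ^ t k = z k) : ordProd u t = (∏ k, z k : Subgroup.center G) := by
  rw [← List.prod_ofFn, ← Subgroup.coe_subtype, map_list_prod, List.map_ofFn]
  simp only [ordProd, h]
  rfl

/-! ### Tail subgroups -/

theorem mem_tailSubgroup (u : Fin m → G) {i : Fin m} {j : ℕ} (h : j ≤ i) :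
    u i ∈ tailSubgroup u j :=
  Subgroup.subset_closure ⟨i, h, rfl⟩

theorem tailSubgroup_le {u : Fin m → G} {j : ℕ} {S : Subgroup G}
    (h : ∀ i : Fin m, j ≤ i → u i ∈ S) : tailSubgroup u j ≤ S := by
  rw [tailSubgroup, Subgroup.closure_le]
  rintro _ ⟨i, hi, rfl⟩
  exact h i hi

theorem tailSubgroup_anti (u : Fin m → G) {i j : ℕ} (h : i ≤ j) :
    tailSubgroup u j ≤ tailSubgroup u i :=
  tailSubgroup_le fun _ hk => mem_tailSubgroup u (h.trans hk)

theorem tailSubgroup_eq_bot (u : Fin m → G) {j : ℕ} (h : m ≤ j) : tailSubgroup u j = ⊥ :=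
  le_bot_iff.1 (tailSubgroup_le fun i hi => by have := i.2; omega)

theorem ordProd_mem_tailSubgroup (u : Fin m → G) {t : Fin m → ℤ} {j : ℕ}
    (h : ∀ k : Fin m, (k : ℕ) < j → t k = 0) : ordProd u t ∈ tailSubgroup u j := by
  refine Subgroup.list_prod_mem _ fun x hx => ?_
  obtain ⟨k, rfl⟩ := (List.mem_ofFn' _ _).1 hx
  by_cases hk : (k : ℕ) < j
  · simp only [h k hk, zpow_zero]; exact one_mem _
  · exact zpow_mem (mem_tailSubgroup u (not_lt.1 hk)) _

theorem map_tailSubgroup_le (f : G →* H) (u : Fin m → G) (j : ℕ) {x : G}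
    (hx : x ∈ tailSubgroup u j) : f x ∈ tailSubgroup (fun k => f (u k)) j :=
  (tailSubgroup_le (S := (tailSubgroup (fun k => f (u k)) j).comap f)
    fun _ hi => mem_tailSubgroup (fun k => f (u k)) hi) hx

/-- The `k`-th factor of an ordered product, up to an element of the next tail subgroup. -/
theorem exists_ordProd_eq (u : Fin m → G) (t : Fin m → ℤ) (k : Fin m) :
    ∃ r ∈ tailSubgroup u (k + 1),
      ordProd u t = ordProd u (fun l => if (l : ℕ) < k then t l else 0) * u k ^ t k * r := by
  refine ⟨ordProd u fun l => if (l : ℕ) < k + 1 then 0 else t l,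
    ordProd_mem_tailSubgroup u fun l hl => if_pos hl, ?_⟩
  rw [ordProd_split u t k, ordProd_split u (fun l => if (l : ℕ) < k then 0 else t l) (k + 1),
    ← ordProd_single, mul_assoc]
  congr 2
  · refine congrArg _ (funext fun l => ?_)
    rcases lt_trichotomy l k with h | rfl | h
    · simp [h, h.ne]
    · simp
    · have : ¬ (l : ℕ) < k + 1 := by omega
      simp [this, h.ne']
  · refine congrArg _ (funext fun l => ?_)
    split_ifs <;> first | rfl | omega

theorem commutator_mem_iff_commute_mk (N : Subgroup G) [N.Normal] (x y : G) :
    ⁅x, y⁆ ∈ N ↔ Commute (x : G ⧸ N) (y : G ⧸ N) := by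
  rw [← QuotientGroup.eq_one_iff, ← commutatorElement_eq_one_iff_commute]
  exact Iff.rfl

theorem normal_tailSubgroup {u : Fin m → G} {j : ℕ}
    (h : ⁅tailSubgroup u j, (⊤ : Subgroup G)⁆ ≤ tailSubgroup u (j + 1)) :
    (tailSubgroup u j).Normal where
  conj_mem x hx g := by
    have h1 : ⁅x, g⁆ ∈ tailSubgroup u j := tailSubgroup_anti u (Nat.le_succ j)
      (h (Subgroup.commutator_mem_commutator hx (Subgroup.mem_top g)))
    have h2 : g * x * g⁻¹ = (⁅x, g⁆)⁻¹ * x := by rw [commutatorElement_def]; group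
    rw [h2]
    exact mul_mem (inv_mem h1) hx

/-- The tail subgroups form a central series as soon as the commutators of the generators allow
it. -/
theorem central_of_generators {u : Fin m → G} (hgen : tailSubgroup u 0 = ⊤)
    (h : ∀ i j : Fin m, ⁅u i, u j⁆ ∈ tailSubgroup u (i + 1)) (j : ℕ) :
    ⁅tailSubgroup u j, (⊤ : Subgroup G)⁆ ≤ tailSubgroup u (j + 1) := by
  rcases le_or_gt m j with hj | hj
  · rw [tailSubgroup_eq_bot u hj, Subgroup.commutator_bot_left]; exact bot_le
  · have ih := central_of_generators hgen h (j + 1)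
    have := normal_tailSubgroup ih
    rw [Subgroup.commutator_le]
    intro x hx y _
    rw [commutator_mem_iff_commute_mk]
    have hy : y ∈ tailSubgroup u 0 := hgen ▸ Subgroup.mem_top y
    have h1 : ∀ i : Fin m, j ≤ i → Commute (y : G ⧸ tailSubgroup u (j + 1)) (u i) := by
      intro i hi
      refine (tailSubgroup_le (S := (Subgroup.centralizer
        {(u i : G ⧸ tailSubgroup u (j + 1))}).comap (QuotientGroup.mk' _)) fun l _ => ?_) hy |>
        Subgroup.mem_centralizer_singleton_iff.1
      refine Subgroup.mem_comap.2 (Subgroup.mem_centralizer_singleton_iff.2 ?_)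
      exact ((commutator_mem_iff_commute_mk _ _ _).1
        (tailSubgroup_anti u (Nat.succ_le_succ hi) (h i l))).symm
    refine (tailSubgroup_le (S := (Subgroup.centralizer
      {(y : G ⧸ tailSubgroup u (j + 1))}).comap (QuotientGroup.mk' _)) fun l hl => ?_) hx |>
      Subgroup.mem_centralizer_singleton_iff.1
    exact Subgroup.mem_comap.2 (Subgroup.mem_centralizer_singleton_iff.2 (h1 l hl).symm)
termination_by m - j

theorem exists_zpow_mul_of_mem_tailSubgroup {u : Fin m → G} (k : Fin m)
    [(tailSubgroup u (k + 1)).Normal] {x : G} (hx : x ∈ tailSubgroup u k) :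
    ∃ a : ℤ, ∃ y ∈ tailSubgroup u (k + 1), x = u k ^ a * y := by
  have h : tailSubgroup u k ≤ Subgroup.zpowers (u k) ⊔ tailSubgroup u (k + 1) := by
    refine tailSubgroup_le fun i hi => ?_
    rcases hi.eq_or_lt with h | h
    · rw [← Fin.ext h]; exact Subgroup.mem_sup_left (Subgroup.mem_zpowers _)
    · exact Subgroup.mem_sup_right (mem_tailSubgroup u h)
  obtain ⟨_, ⟨a, rfl⟩, y, hy, rfl⟩ := Subgroup.mem_sup_of_normal_right.1 (h hx)
  exact ⟨a, y, hy, rfl⟩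

/-! ### Coordinates with respect to a pseudo-basis -/

namespace IsPseudoBasis

variable {u : Fin m → G} {e : Fin m → ℕ}

/-- Elements of a tail subgroup have coordinates, which vanish below the start of the tail. -/
theorem exists_isCoord (hu : IsPseudoBasis u e) (j : ℕ) {g : G} (hg : g ∈ tailSubgroup u j) :
    ∃ t, IsCoord u e g t ∧ ∀ k : Fin m, (k : ℕ) < j → t k = 0 := by
  rcases le_or_gt m j with hj | hj
  · rw [tailSubgroup_eq_bot u hj, Subgroup.mem_bot] at hg
    exact ⟨fun _ => 0, ⟨fun k hk => ⟨le_rfl, by dsimp only; omega⟩, by rw [ordProd_zero, hg]⟩,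
      fun _ _ => rfl⟩
  · have := normal_tailSubgroup (hu.central (j + 1))
    obtain ⟨k, rfl⟩ : ∃ k : Fin m, (k : ℕ) = j := ⟨⟨j, hj⟩, rfl⟩
    obtain ⟨a, y, hy, rfl⟩ := exists_zpow_mul_of_mem_tailSubgroup k hg
    have h1 : u k ^ ((e k : ℤ) * (a / e k)) ∈ tailSubgroup u (k + 1) :=
      (hu.period k _).2 (dvd_mul_right _ _)
    obtain ⟨t, ⟨ht, hty⟩, ht0⟩ := hu.exists_isCoord (k + 1) (mul_mem h1 hy)
    have hlt : ∀ l : Fin m, l ≠ k → (Function.update t k (a % e k)) l = t l := fun l hl => by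
      rw [Function.update_of_ne hl]
    refine ⟨Function.update t k (a % e k), ⟨fun l hl => ?_, ?_⟩, fun l hl => ?_⟩
    · by_cases hlk : l = k
      · subst hlk
        rw [Function.update_self]
        exact ⟨Int.emod_nonneg _ (by exact_mod_cast hl),
          Int.emod_lt_of_pos _ (by exact_mod_cast Nat.pos_of_ne_zero hl)⟩
      · rw [hlt l hlk]; exact ht l hl
    · have ha : u k ^ a * y = u k ^ (a % e k) * (u k ^ ((e k : ℤ) * (a / e k)) * y) := by
        rw [← mul_assoc, ← zpow_add, Int.emod_add_mul_ediv]
      rw [ordProd_split _ _ (k + 1), ha, hty, ← ordProd_single]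
      congr 1
      · refine congrArg _ (funext fun l => ?_)
        by_cases hlk : l = k
        · subst hlk; simp
        · rw [hlt l hlk, Pi.single_eq_of_ne hlk]
          split_ifs with h
          · exact (ht0 l h).symm
          · rfl
      · refine congrArg _ (funext fun l => ?_)
        split_ifs with h
        · exact ht0 l h
        · rw [hlt l (by rintro rfl; omega)]
    · rw [hlt l (by rintro rfl; omega)]; exact ht0 l (by omega)
termination_by m - j

/-- Elements that agree modulo a tail subgroup have the same coordinates up to there. -/
theorem coord_eq_of_inv_mul_mem (hu : IsPseudoBasis u e) {g g' : G} {t t' : Fin m → ℤ}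
    (h : IsCoord u e g t) (h' : IsCoord u e g' t') {j : ℕ} (hj : g⁻¹ * g' ∈ tailSubgroup u j)
    (k : Fin m) (hk : (k : ℕ) < j) : t k = t' k := by
  induction hn : (k : ℕ) using Nat.strong_induction_on generalizing k with | _ n ih
  subst hn
  -- Cancelling the common initial factors shows that `u k ^ (t' k - t k)` lies in the next tail
  -- subgroup.
  obtain ⟨r, hr, h1⟩ := exists_ordProd_eq u t k
  obtain ⟨r', hr', h2⟩ := exists_ordProd_eq u t' k
  have h3 : (fun l : Fin m => if (l : ℕ) < k then t l else 0) =
      fun l : Fin m => if (l : ℕ) < k then t' l else 0 := by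
    funext l
    split_ifs with hl
    · exact ih l hl l (by omega) rfl
    · rfl
  have h4 : u k ^ (t' k - t k) = r * (g⁻¹ * g') * r'⁻¹ := by
    rw [h.2, h'.2, h1, h2, h3, zpow_sub]
    have : Commute (u k ^ t k)⁻¹ (u k ^ t' k) := ((Commute.refl _).zpow_zpow _ _).inv_left
    rw [← this.eq]
    group
  have h5 : (e k : ℤ) ∣ t' k - t k := by
    rw [← hu.period k, h4]
    exact mul_mem (mul_mem hr (tailSubgroup_anti u hk hj)) (inv_mem hr')
  by_cases hk0 : e k = 0
  · rw [hk0, Nat.cast_zero, zero_dvd_iff] at h5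
    omega
  · have h6 := h.1 k hk0
    have h7 := h'.1 k hk0
    have h8 := Int.eq_zero_of_abs_lt_dvd h5 (by rw [abs_lt]; omega)
    omega

theorem isCoord_one (u : Fin m → G) (e : Fin m → ℕ) : IsCoord u e 1 fun _ => 0 :=
  ⟨fun k hk => ⟨le_rfl, by dsimp only; omega⟩, (ordProd_zero u).symm⟩

theorem coord_eq_zero (hu : IsPseudoBasis u e) {g : G} {t : Fin m → ℤ} (h : IsCoord u e g t)
    {j : ℕ} (hj : g ∈ tailSubgroup u j) (k : Fin m) (hk : (k : ℕ) < j) : t k = 0 :=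
  hu.coord_eq_of_inv_mul_mem h (isCoord_one u e) (by simpa using hj) k hk

theorem coord_unique (hu : IsPseudoBasis u e) {g : G} {t t' : Fin m → ℤ}
    (h : IsCoord u e g t) (h' : IsCoord u e g t') : t = t' :=
  funext fun k => hu.coord_eq_of_inv_mul_mem h h' (j := m) (by simp) k k.2

theorem commutator_mem (hu : IsPseudoBasis u e) (i j : Fin m) :
    ⁅u i, u j⁆ ∈ tailSubgroup u (i + 1) :=
  hu.central i (Subgroup.commutator_mem_commutator (mem_tailSubgroup u le_rfl)
    (Subgroup.mem_top _))

theorem pow_mem (hu : IsPseudoBasis u e) (i : Fin m) :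
    u i ^ e i ∈ tailSubgroup u (i + 1) := by
  rw [← zpow_natCast, hu.period]

theorem ext_of_generates (hu : IsPseudoBasis u e) {S : Subgroup G} (h : ∀ i, u i ∈ S) (g : G) :
    g ∈ S :=
  tailSubgroup_le (fun i _ => h i) (hu.generates ▸ Subgroup.mem_top g)

/-- **Von Dyck's theorem** for the presentation given by a pseudo-basis: elements of `H` that
satisfy the relations of the generators `u` are the images of `u` under a homomorphism.  The proof
shows that the subgroup of `G × H` generated by the pairs `(u i, w i)` is a graph: in this subgroup,
an element `(1, h)` lies in each of the tail subgroups. -/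
theorem exists_hom (hu : IsPseudoBasis u e) (w : Fin m → H)
    (hcomm : ∀ i j : Fin m, ∃ t : Fin m → ℤ, (∀ k : Fin m, (k : ℕ) < i + 1 → t k = 0) ∧
      ⁅u i, u j⁆ = ordProd u t ∧ ⁅w i, w j⁆ = ordProd w t)
    (hpow : ∀ i, e i ≠ 0 → ∃ t : Fin m → ℤ, (∀ k : Fin m, (k : ℕ) < i + 1 → t k = 0) ∧
      u i ^ e i = ordProd u t ∧ w i ^ e i = ordProd w t) :
    ∃ φ : G →* H, ∀ i, φ (u i) = w i := by
  let Γ : Subgroup (G × H) := Subgroup.closure (Set.range fun i => (u i, w i))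
  let p : Fin m → Γ := fun i => ⟨(u i, w i), Subgroup.subset_closure ⟨i, rfl⟩⟩
  let π : Γ →* G := (MonoidHom.fst G H).comp Γ.subtype
  let σ : Γ →* H := (MonoidHom.snd G H).comp Γ.subtype
  have hπσ : ∀ {x y : Γ}, π x = π y → σ x = σ y → x = y := fun h1 h2 =>
    Subtype.ext (Prod.ext h1 h2)
  have hgen : tailSubgroup p 0 = ⊤ := by
    rw [← top_le_iff, ← Subgroup.map_subtype_le_map_subtype, ← MonoidHom.range_eq_map,
      Subgroup.range_subtype, Subgroup.closure_le]
    rintro _ ⟨i, rfl⟩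
    exact ⟨p i, mem_tailSubgroup p (Nat.zero_le _), rfl⟩
  have hcomm' : ∀ i j : Fin m, ⁅p i, p j⁆ ∈ tailSubgroup p (i + 1) := by
    intro i j
    obtain ⟨t, ht, h1, h2⟩ := hcomm i j
    have : ⁅p i, p j⁆ = ordProd p t := by
      refine hπσ ?_ ?_
      · rw [map_commutatorElement, map_ordProd]; exact h1
      · rw [map_commutatorElement, map_ordProd]; exact h2
    rw [this]
    exact ordProd_mem_tailSubgroup p ht
  -- For infinite period, encoded as `e i = 0`, the power is `1`.
  have hpow' : ∀ i : Fin m, p i ^ e i ∈ tailSubgroup p (i + 1) := by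
    intro i
    by_cases hi : e i = 0
    · rw [hi, pow_zero]; exact one_mem _
    obtain ⟨t, ht, h1, h2⟩ := hpow i hi
    have : p i ^ e i = ordProd p t := by
      refine hπσ ?_ ?_
      · rw [map_pow, map_ordProd]; exact h1
      · rw [map_pow, map_ordProd]; exact h2
    rw [this]
    exact ordProd_mem_tailSubgroup p ht
  have hker : ∀ x, π x = 1 → ∀ j ≤ m, x ∈ tailSubgroup p j := by
    intro x hx j
    induction j with
    | zero => exact fun _ => hgen ▸ Subgroup.mem_top x
    | succ j ih =>
      intro hj
      have := normal_tailSubgroup (central_of_generators hgen hcomm' (j + 1))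
      obtain ⟨k, rfl⟩ : ∃ k : Fin m, (k : ℕ) = j := ⟨⟨j, hj⟩, rfl⟩
      obtain ⟨a, y, hy, rfl⟩ := exists_zpow_mul_of_mem_tailSubgroup k (ih (by omega))
      rw [map_mul, map_zpow, mul_eq_one_iff_eq_inv] at hx
      have h1 : u k ^ a ∈ tailSubgroup u (k + 1) := by
        have : π (p k) = u k := rfl
        rw [← this, hx]
        exact inv_mem (map_tailSubgroup_le π p _ hy)
      obtain ⟨b, rfl⟩ := (hu.period k a).1 h1
      refine mul_mem ?_ hy
      rw [zpow_mul, zpow_natCast]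
      exact zpow_mem (hpow' k) b
  have hinj : Function.Injective π := by
    rw [injective_iff_map_eq_one]
    intro x hx
    have := hker x hx m le_rfl
    rwa [tailSubgroup_eq_bot p le_rfl, Subgroup.mem_bot] at this
  have hsurj : Function.Surjective π := fun g =>
    hu.ext_of_generates (S := π.range) (fun i => ⟨p i, rfl⟩) g
  let f := MulEquiv.ofBijective π ⟨hinj, hsurj⟩
  refine ⟨σ.comp f.symm.toMonoidHom, fun i => ?_⟩
  have : f.symm (u i) = p i := f.symm_apply_eq.2 rfl
  exact congrArg σ this

end IsPseudoBasis

end OrdProd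

/-! ### Lattices in the centre -/

section Lattice

variable {G H : Type*} [Group G] [Group H] {m n : ℕ}

open scoped IsMulCommutative in
/-- The homomorphism from `ℤⁿ`, written multiplicatively, to `G` which maps the standard basis to
the given central elements. -/
def centralZpowHom (z : Fin n → Subgroup.center G) : Multiplicative (Fin n → ℤ) →* G :=
  (Subgroup.center G).subtype.comp
    { toFun := fun x => ∏ l, z l ^ x.toAdd l
      map_one' := by simp
      map_mul' := fun x y => by simp [zpow_add, Finset.prod_mul_distrib] }

theorem centralZpowHom_comm (z : Fin n → Subgroup.center G) (x : Multiplicative (Fin n → ℤ))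
    (g : G) : centralZpowHom z x * g = g * centralZpowHom z x :=
  (Subgroup.mem_center_iff.1 (Subtype.prop _) g).symm

theorem centralZpowHom_mem_center (z : Fin n → Subgroup.center G)
    (x : Multiplicative (Fin n → ℤ)) : centralZpowHom z x ∈ Subgroup.center G :=
  Subtype.prop _

theorem centralZpowHom_eq_ordProd (z : Fin n → Subgroup.center G) (x : Fin n → ℤ) :
    centralZpowHom z (Multiplicative.ofAdd x) = ordProd (fun l => (z l : G)) x :=
  (ordProd_eq_prod_center (fun l => z l ^ x l) _ x fun _ => rfl).symm

theorem centralZpowHom_single (z : Fin n → Subgroup.center G) (l : Fin n) :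
    centralZpowHom z (Multiplicative.ofAdd (Pi.single l 1)) = z l := by
  rw [centralZpowHom_eq_ordProd, ordProd_single, zpow_one]

open scoped IsMulCommutative in
theorem centralZpowHom_eq_ordProd_extend (z : Fin n → Subgroup.center G) {u : Fin m → G}
    {f : Fin n → Fin m} (hf : Function.Injective f) (hz : ∀ l, u (f l) = z l) (x : Fin n → ℤ) :
    centralZpowHom z (Multiplicative.ofAdd x) = ordProd u (Function.extend f x 0) := by
  have hcoe : ∀ k, u k ^ Function.extend f x 0 k =
      (Function.extend f (fun l => z l ^ x l) 1 k : Subgroup.center G) := by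
    intro k
    by_cases hk : ∃ l, f l = k
    · obtain ⟨l, rfl⟩ := hk
      rw [hf.extend_apply, hf.extend_apply, hz]
      rfl
    · rw [Function.extend_apply' _ _ _ hk, Function.extend_apply' _ _ _ hk]
      simp
  rw [ordProd_eq_prod_center _ u _ hcoe]
  refine congrArg Subtype.val (Fintype.prod_of_injective f hf _ _ (fun k hk => ?_) fun l => ?_)
  · exact Function.extend_apply' _ _ _ hk
  · exact (hf.extend_apply (fun l => z l ^ x l) 1 l).symm

/-- Elements of a central lattice that is spanned by members of infinite period are given by
their coordinates. -/
theorem isCoord_centralZpowHom (z : Fin n → Subgroup.center G) {u : Fin m → G} {e : Fin m → ℕ}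
    {f : Fin n → Fin m} (hf : Function.Injective f) (hz : ∀ l, u (f l) = z l)
    (he : ∀ l, e (f l) = 0) (x : Fin n → ℤ) :
    IsCoord u e (centralZpowHom z (Multiplicative.ofAdd x)) (Function.extend f x 0) := by
  refine ⟨fun k hk => ?_, centralZpowHom_eq_ordProd_extend z hf hz x⟩
  have : ¬ ∃ l, f l = k := by rintro ⟨l, rfl⟩; exact hk (he l)
  rw [Function.extend_apply' _ _ _ this, Pi.zero_apply]
  omega

/-- A homomorphism that maps the generators of a central lattice to the rows of `Ψ` acts on the
lattice by `x ↦ x Ψ`, where `x` is a row vector. -/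
theorem map_centralZpowHom (z : Fin n → Subgroup.center G) (z' : Fin n → Subgroup.center H)
    (φ : G →* H) (Ψ : Matrix (Fin n) (Fin n) ℤ)
    (h : ∀ l, φ (z l) = centralZpowHom z' (Multiplicative.ofAdd (Ψ l))) (x : Fin n → ℤ) :
    φ (centralZpowHom z (Multiplicative.ofAdd x)) =
      centralZpowHom z' (Multiplicative.ofAdd (Matrix.vecMul x Ψ)) := by
  rw [centralZpowHom_eq_ordProd, map_ordProd]
  simp only [h]
  rw [← map_ordProd, ordProd, List.prod_ofFn]
  congr 1
  refine Multiplicative.toAdd.injective ?_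
  rw [toAdd_prod]
  simp [Matrix.vecMul_eq_sum]

theorem commutator_mul_central {a b : G} (ha : a ∈ Subgroup.center G)
    (hb : b ∈ Subgroup.center G) (x y : G) : ⁅x * a, y * b⁆ = ⁅x, y⁆ := by
  rw [Subgroup.mem_center_iff] at ha hb
  have h1 : x * a * (y * b) = a * b * (x * y) := by
    rw [ha, mul_assoc a, ← mul_assoc x y b, hb, mul_assoc]
  have h2 : y * b * (x * a) = a * b * (y * x) := by
    rw [hb, mul_assoc b, ← mul_assoc y x a, ha, ← mul_assoc, ← mul_assoc, ← mul_assoc, ha b]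
  have h3 : ∀ p q : G, ⁅p, q⁆ = p * q * (q * p)⁻¹ := fun p q => by
    rw [commutatorElement_def]; group
  have h4 : ∀ p : G, a * b * p = p * (a * b) := fun p => by
    rw [mul_assoc, ← hb p, ← mul_assoc, ← ha, mul_assoc]
  rw [h3, h3, h1, h2, h4, h4]
  group

end Lattice

/-! ### Homomorphisms to an abelian deformation -/

namespace Blocks

variable (B : Blocks)

theorem tor_val (j : Fin B.n) : (B.tor j : ℕ) = B.i₀ + j := rfl

theorem add_val (l : Fin B.n) : (B.add l : ℕ) = B.i₀ + B.n + l := rfl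

theorem i₁_eq : B.i₁ = B.i₀ + B.n := rfl

theorem add_injective : Function.Injective B.add := fun l l' h => by
  have := congrArg Fin.val h
  simp only [add_val] at this
  exact Fin.ext (by omega)

theorem tor_injective : Function.Injective B.tor := fun l l' h => by
  have := congrArg Fin.val h
  simp only [tor_val] at this
  exact Fin.ext (by omega)

theorem add_lt (l : Fin B.n) : (B.add l : ℕ) < B.i₂ := by
  have := B.le_i₂; rw [add_val]; omega

theorem i₁_le_add (l : Fin B.n) : B.i₁ ≤ (B.add l : ℕ) := by
  rw [add_val, i₁_eq]; omega

theorem tor_lt_add (j l : Fin B.n) : (B.tor j : ℕ) < B.add l := by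
  rw [add_val, tor_val]; omega

theorem not_exists_add_eq_tor (j : Fin B.n) : ¬ ∃ l, B.add l = B.tor j := by
  rintro ⟨l, h⟩
  have := B.tor_lt_add j l
  rw [h] at this
  omega

theorem exists_tor_eq {i : Fin B.m} (h : B.i₀ ≤ (i : ℕ)) (h' : (i : ℕ) < B.i₁) :
    ∃ j, B.tor j = i :=
  ⟨⟨i - B.i₀, by rw [i₁_eq] at h'; omega⟩, Fin.ext (by rw [tor_val]; dsimp only; omega)⟩

end Blocks

section Deformation

variable {G H : Type*} [Group G] [Group H] {B : Blocks} {u : Fin B.m → G} {e : Fin B.m → ℕ}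
  {d : Fin B.n → ℤ} {c : Matrix (Fin B.n) (Fin B.n) ℤ} {v : Fin B.m → H}

namespace IsAdaptedPseudoBasis

theorem add_mem_center (hu : IsAdaptedPseudoBasis B u e) (l : Fin B.n) :
    u (B.add l) ∈ Subgroup.center G :=
  hu.central_add _ (B.i₁_le_add l) (B.add_lt l)

theorem period_add_eq_zero (hu : IsAdaptedPseudoBasis B u e) (l : Fin B.n) : e (B.add l) = 0 :=
  hu.period_add _ (B.i₁_le_add l) (B.add_lt l)

theorem commutator_le_tail (hu : IsAdaptedPseudoBasis B u e) :
    commutator G ≤ tailSubgroup u B.i₂ := by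
  intro g hg
  rw [← SetLike.mem_coe, hu.tail_i₂]
  exact ⟨1, one_ne_zero, by rwa [pow_one]⟩

end IsAdaptedPseudoBasis

namespace IsAbelianDeformation

/-- Central members of `u` have trivial commutators with all of `u`, and so do the corresponding
members of `v`, which have the same structure constants. -/
theorem mem_center (hu : IsPseudoBasis u e) (hv : IsAbelianDeformation B u e d c v)
    (k : Fin B.m) (hk : u k ∈ Subgroup.center G) : v k ∈ Subgroup.center H := by
  rw [Subgroup.mem_center_iff]
  intro g
  have h : g ∈ Subgroup.centralizer {v k} := by
    refine hv.pseudoBasis.ext_of_generates (fun j => ?_) g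
    rw [Subgroup.mem_centralizer_singleton_iff]
    change Commute _ _
    rw [← commutatorElement_eq_one_iff_commute]
    obtain ⟨t, ht, h⟩ := hv.comm j k
    have h1 : ⁅u j, u k⁆ = 1 :=
      commutatorElement_eq_one_iff_commute.2 (Subgroup.mem_center_iff.1 hk _)
    rw [h1] at ht
    rw [h, hu.coord_unique ht (IsPseudoBasis.isCoord_one u e), ordProd_zero]
  exact Subgroup.mem_centralizer_singleton_iff.1 h

/-- Integers `d'` congruent to `d` modulo the periods give a homomorphism to the abelian
deformation `Abdef(G, d, c)`.  It is given by the matrix `c * diagonal d'` on the lattice spanned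
by the central generators; the differences `d' - d` are compensated by changing the images of the
generators of `M(G) / N(G)` by central elements. -/
theorem exists_hom (hu : IsAdaptedPseudoBasis B u e) (hv : IsAbelianDeformation B u e d c v)
    (z : Fin B.n → Subgroup.center H) (hz : ∀ l, v (B.add l) = z l) (d' : Fin B.n → ℤ)
    (hd' : ∀ j l, (e (B.tor j) : ℤ) ∣ d' l - d l) :
    ∃ φ : G →* H, (∀ k, ∃ x, φ (u k) = v k * centralZpowHom z x) ∧
      ∀ l, φ (u (B.add l)) =
        centralZpowHom z (Multiplicative.ofAdd ((c * Matrix.diagonal d') l)) := by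
  choose s hs using hd'
  -- `A j` is the lattice vector with `c j l * d' l = d l * c j l + e (tor j) * A j l`.
  let A : Fin B.n → Fin B.n → ℤ := fun j l => s j l * c j l
  let y : Fin B.m → Fin B.n → ℤ :=
    Function.extend B.add (fun l => (c * Matrix.diagonal d') l - Pi.single l 1)
      (Function.extend B.tor A 0)
  let b := centralZpowHom z
  -- The images of the generators: `w k` differs from `v k` by a central factor, so that the
  -- commutators are unchanged.
  let w : Fin B.m → H := fun k => v k * b (Multiplicative.ofAdd (y k))
  have hw_add : ∀ l, w (B.add l) = b (Multiplicative.ofAdd ((c * Matrix.diagonal d') l)) := by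
    intro l
    have : v (B.add l) = b (Multiplicative.ofAdd (Pi.single l 1)) := by
      rw [hz]; exact (centralZpowHom_single z l).symm
    simp only [w, y, B.add_injective.extend_apply, this]
    rw [← map_mul, ← ofAdd_add, add_sub_cancel]
  have hw_tor : ∀ j, w (B.tor j) = v (B.tor j) * b (Multiplicative.ofAdd (A j)) := by
    intro j
    simp only [w, y, Function.extend_apply' _ _ _ (B.not_exists_add_eq_tor j),
      B.tor_injective.extend_apply]
  have hw_tail : ∀ k : Fin B.m, B.i₂ ≤ (k : ℕ) → w k = v k := by
    intro k hk
    have h1 : ¬ ∃ l, B.add l = k := by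
      rintro ⟨l, rfl⟩; have := B.add_lt l; omega
    have h2 : ¬ ∃ l, B.tor l = k := by
      rintro ⟨l, rfl⟩; have := B.add_lt l; have := B.tor_lt_add l l; omega
    simp only [w, y, Function.extend_apply' _ _ _ h1, Function.extend_apply' _ _ _ h2]
    simp
  have hw_ord : ∀ t : Fin B.m → ℤ, (∀ k : Fin B.m, (k : ℕ) < B.i₂ → t k = 0) →
      ordProd v t = ordProd w t := by
    intro t ht
    refine ordProd_congr fun k => ?_
    rcases lt_or_ge (k : ℕ) B.i₂ with hk | hk
    · rw [ht k hk, zpow_zero, zpow_zero]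
    · rw [hw_tail k hk]
  suffices h : ∃ φ : G →* H, ∀ i, φ (u i) = w i by
    obtain ⟨φ, hφ⟩ := h
    refine ⟨φ, fun k => ⟨_, hφ k⟩, fun l => ?_⟩
    rw [hφ, hw_add]
  refine hu.toIsPseudoBasis.exists_hom w ?_ ?_
  · intro i j
    obtain ⟨t, ht, h⟩ := hv.comm i j
    refine ⟨t, fun k hk => hu.coord_eq_zero ht (hu.commutator_mem i j) k hk, ht.2, ?_⟩
    rw [commutator_mul_central (centralZpowHom_mem_center z _) (centralZpowHom_mem_center z _), h]
    exact hw_ord t fun k hk => hu.coord_eq_zero ht (hu.commutator_le_tail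
      (Subgroup.commutator_mem_commutator (Subgroup.mem_top _) (Subgroup.mem_top _))) k hk
  · intro i hi
    by_cases hij : B.i₀ ≤ (i : ℕ) ∧ (i : ℕ) < B.i₁
    · obtain ⟨j, rfl⟩ := B.exists_tor_eq hij.1 hij.2
      obtain ⟨t, ht, ht2⟩ := hu.normalised j
      obtain ⟨t', ht', h⟩ := hv.pow_tor j
      obtain rfl := hu.coord_unique ht ht'
      refine ⟨t, fun k hk => hu.coord_eq_zero ht (hu.pow_mem _) k hk, ht.2, ?_⟩
      have h1 : ordProd w (fun k => if (k : ℕ) < B.i₂ then t k else 0) =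
          b (Multiplicative.ofAdd ((c * Matrix.diagonal d') j)) := by
        rw [← hw_add, ← zpow_one (w _), ← ordProd_single]
        refine congrArg _ (funext fun k => ?_)
        by_cases hk : (k : ℕ) < B.i₂
        · rw [if_pos hk, ht2 k hk, Pi.single_apply]
        · rw [if_neg hk, Pi.single_eq_of_ne]
          rintro rfl
          exact hk (B.add_lt j)
      have h2 : ordProd w (fun k => if (k : ℕ) < B.i₂ then 0 else t k) =
          ordProd v fun k => if B.i₂ ≤ (k : ℕ) then t k else 0 := by
        rw [← hw_ord _ fun k hk => if_pos hk]
        refine congrArg _ (funext fun k => ?_)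
        split_ifs <;> first | rfl | omega
      have h3 : (List.ofFn fun l : Fin B.n => v (B.add l) ^ (d l * c j l)).prod =
          b (Multiplicative.ofAdd fun l => d l * c j l) := by
        simp only [b, centralZpowHom_eq_ordProd, ordProd, hz]
      have h4 : (c * Matrix.diagonal d') j = (fun l => d l * c j l) + e (B.tor j) • A j := by
        funext l
        have := hs j l
        rw [Matrix.mul_diagonal, Pi.add_apply, Pi.smul_apply, nsmul_eq_mul]
        simp only [A]
        rw [sub_eq_iff_eq_add.1 this]
        ring
      rw [ordProd_split w t B.i₂, h1, h2, hw_tor,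
        (show Commute (v (B.tor j)) (b _) from (centralZpowHom_comm z _ _).symm).mul_pow, h, h3,
        h4, ofAdd_add, map_mul, ofAdd_nsmul, map_pow, mul_assoc, mul_assoc, ← map_pow]
      congr 1
      exact (centralZpowHom_comm z _ _).symm
    · obtain ⟨t, ht, h⟩ := hv.pow i hij hi
      have hi2 : B.i₂ ≤ (i : ℕ) := by
        by_contra h2
        refine hi ?_
        rcases lt_or_ge (i : ℕ) B.i₀ with h0 | h0
        · exact hu.period_free i h0
        · exact hu.period_add i (by omega) (by omega)
      have h0 := fun k hk => hu.coord_eq_zero ht (hu.pow_mem i) k hk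
      refine ⟨t, h0, ht.2, ?_⟩
      rw [hw_tail i hi2, h]
      exact hw_ord t fun k hk => h0 k (by omega)

end IsAbelianDeformation

end Deformation

/-! ### Invertibility modulo integers -/

/-- A residue class prime to `E` contains integers prime to any given `K`. -/
theorem exists_dvd_sub_isCoprime {E K : ℕ} (hE : E ≠ 0) (hK : K ≠ 0) {d : ℤ}
    (hd : IsCoprime d E) : ∃ d' : ℤ, (E : ℤ) ∣ d' - d ∧ IsCoprime d' K := by
  have : NeZero (E * K) := ⟨mul_ne_zero hE hK⟩
  obtain ⟨y, hy⟩ := ZMod.unitsMap_surjective (dvd_mul_right E K) (ZMod.unitOfIsCoprime d hd)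
  refine ⟨((y : ZMod (E * K)).val : ℤ), ?_, ?_⟩
  · have h := congrArg Units.val hy
    rw [ZMod.unitsMap_val, ZMod.coe_unitOfIsCoprime] at h
    rw [← ZMod.intCast_zmod_eq_zero_iff_dvd, Int.cast_sub, ← h]
    simp
  · rw [Nat.isCoprime_iff_coprime]
    exact (ZMod.val_coe_unit_coprime y).coprime_mul_left_right

theorem isCoprime_det_mul_diagonal {n : ℕ} {c : Matrix (Fin n) (Fin n) ℤ} (hc : |c.det| = 1)
    {d : Fin n → ℤ} {K : ℤ} (hd : ∀ l, IsCoprime (d l) K) :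
    IsCoprime (c * Matrix.diagonal d).det K := by
  rw [Matrix.det_mul, Matrix.det_diagonal]
  refine IsCoprime.mul_left ?_ (IsCoprime.prod_left fun l _ => hd l)
  exact ⟨c.det, 0, by rw [zero_mul, add_zero, ← abs_mul_abs_self, hc, one_mul]⟩

/-- A matrix whose determinant is prime to `K` is surjective modulo `K`; the adjugate provides
the preimages. -/
theorem exists_vecMul_add_smul {n : ℕ} {Ψ : Matrix (Fin n) (Fin n) ℤ} {K : ℤ}
    (h : IsCoprime Ψ.det K) (x : Fin n → ℤ) :
    ∃ y y' : Fin n → ℤ, x = Matrix.vecMul y Ψ + K • y' := by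
  obtain ⟨a, b, hab⟩ := h
  refine ⟨Matrix.vecMul (a • x) Ψ.adjugate, b • x, ?_⟩
  rw [Matrix.vecMul_vecMul, Matrix.adjugate_mul, Matrix.vecMul_smul, Matrix.vecMul_one, smul_smul,
    smul_smul, ← add_smul, mul_comm _ a, mul_comm K b, hab, one_smul]

/-- A matrix whose determinant is prime to `M` is injective modulo `M`. -/
theorem exists_smul_of_vecMul_eq_smul {n : ℕ} {Ψ : Matrix (Fin n) (Fin n) ℤ} {M : ℤ}
    (h : IsCoprime Ψ.det M) {x y : Fin n → ℤ} (hxy : Matrix.vecMul x Ψ = M • y) :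
    ∃ z : Fin n → ℤ, x = M • z := by
  obtain ⟨a, b, hab⟩ := h
  refine ⟨a • Matrix.vecMul y Ψ.adjugate + b • x, ?_⟩
  have h1 : Ψ.det • x = M • Matrix.vecMul y Ψ.adjugate := by
    rw [← Matrix.smul_vecMul, ← hxy, Matrix.vecMul_vecMul, Matrix.mul_adjugate, Matrix.vecMul_smul,
      Matrix.vecMul_one]
  rw [smul_add, smul_comm M a, ← h1, smul_smul, smul_smul, ← add_smul, mul_comm M b, hab, one_smul]

/-! ### Isomorphism modulo the central lattice -/

section Deformation

variable {G H : Type*} [Group G] [Group H] {B : Blocks} {u : Fin B.m → G} {e : Fin B.m → ℕ}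
  {v : Fin B.m → H}

/-- A homomorphism that maps `u` to `v` modulo the central lattices reflects these lattices:
modulo them, it preserves the coordinates outside the block of the lattice. -/
theorem exists_eq_centralZpowHom_of_map_eq (hu : IsPseudoBasis u e) (hv : IsPseudoBasis v e)
    (he : ∀ l, e (B.add l) = 0) (z : Fin B.n → Subgroup.center G)
    (hz : ∀ l, u (B.add l) = z l) (z' : Fin B.n → Subgroup.center H)
    (hz' : ∀ l, v (B.add l) = z' l) {φ : G →* H}
    (hφ : ∀ k, ∃ x, φ (u k) = v k * centralZpowHom z' x) (g : G)
    (y : Multiplicative (Fin B.n → ℤ)) (hg : φ g = centralZpowHom z' y) :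
    ∃ x, g = centralZpowHom z x := by
  classical
  let N := (centralZpowHom z').range
  have hN : N.Normal := ⟨fun _ ⟨x, hx⟩ h => ⟨x, by
    rw [← hx, ← centralZpowHom_comm, mul_assoc, mul_inv_cancel, mul_one]⟩⟩
  obtain ⟨t, ht, -⟩ := hu.exists_isCoord 0 (hu.generates ▸ Subgroup.mem_top g)
  -- Modulo the lattice of `H`, the image of `g` has the coordinates of `g` with the entries of the
  -- lattice block deleted.
  let s : Fin B.m → ℤ := fun k => if ∃ l, B.add l = k then 0 else t k
  have h1 : QuotientGroup.mk' N (φ g) = QuotientGroup.mk' N (ordProd v s) := by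
    rw [ht.2, map_ordProd, map_ordProd, map_ordProd]
    refine ordProd_congr fun k => ?_
    have h2 : QuotientGroup.mk' N (φ (u k)) = QuotientGroup.mk' N (v k) := by
      obtain ⟨x, hx⟩ := hφ k
      rw [hx]
      exact QuotientGroup.mk_mul_of_mem _ ⟨x, rfl⟩
    rw [h2]
    by_cases hk : ∃ l, B.add l = k
    · obtain ⟨l, rfl⟩ := hk
      have h3 : QuotientGroup.mk' N (v (B.add l)) = 1 :=
        (QuotientGroup.eq_one_iff _).2 ⟨_, (centralZpowHom_single z' l).trans (hz' l).symm⟩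
      rw [h3, one_zpow, one_zpow]
    · simp only [s, if_neg hk]
  have h4 : ordProd v s ∈ N := by
    rw [← QuotientGroup.eq_one_iff]
    refine h1.symm.trans ((QuotientGroup.eq_one_iff _).2 ⟨y, hg.symm⟩)
  obtain ⟨y', hy'⟩ := h4
  have hs : IsCoord v e (ordProd v s) s := by
    refine ⟨fun k hk => ?_, rfl⟩
    have : ¬ ∃ l, B.add l = k := by rintro ⟨l, rfl⟩; exact hk (he l)
    simp only [s, if_neg this]
    exact ht.1 k hk
  have hs' : IsCoord v e (ordProd v s) (Function.extend B.add y'.toAdd 0) := by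
    rw [← hy']
    exact isCoord_centralZpowHom z' B.add_injective hz' he y'.toAdd
  have h5 := hv.coord_unique hs hs'
  refine ⟨Multiplicative.ofAdd fun l => t (B.add l), ?_⟩
  rw [centralZpowHom_eq_ordProd_extend z B.add_injective hz, ht.2]
  refine congrArg _ (funext fun k => ?_)
  by_cases hk : ∃ l, B.add l = k
  · obtain ⟨l, rfl⟩ := hk
    rw [B.add_injective.extend_apply]
  · have h6 := congrFun h5 k
    simp only [s, if_neg hk] at h6
    rw [h6, Function.extend_apply' _ _ _ hk, Function.extend_apply' _ _ _ hk]

/-- A homomorphism that maps `u` to `v` modulo the central lattices, and the lattice of `G` to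
that of `H` by a matrix which is invertible modulo `K`, is onto modulo the `K`-th powers of the
lattice. -/
theorem exists_eq_map_mul_pow (hv : IsPseudoBasis v e) (z : Fin B.n → Subgroup.center G)
    (z' : Fin B.n → Subgroup.center H) {φ : G →* H}
    (hφ : ∀ k, ∃ x, φ (u k) = v k * centralZpowHom z' x) {Ψ : Matrix (Fin B.n) (Fin B.n) ℤ}
    (hΨ : ∀ x, φ (centralZpowHom z (Multiplicative.ofAdd x)) =
      centralZpowHom z' (Multiplicative.ofAdd (Matrix.vecMul x Ψ)))
    {K : ℕ} (hK : IsCoprime Ψ.det K) (h : H) :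
    ∃ g y, h = φ g * centralZpowHom z' (y ^ K) := by
  let N := ((centralZpowHom z').comp (powMonoidHom K)).range
  have hN : N.Normal := ⟨fun _ ⟨x, hx⟩ h => ⟨x, by
    rw [← hx, MonoidHom.comp_apply, ← centralZpowHom_comm, mul_assoc, mul_inv_cancel, mul_one]⟩⟩
  suffices h : h ∈ φ.range ⊔ N by
    obtain ⟨_, ⟨g, rfl⟩, _, ⟨y, rfl⟩, hgy⟩ := Subgroup.mem_sup_of_normal_right.1 h
    exact ⟨g, y, hgy.symm⟩
  have hlat : ∀ x, centralZpowHom z' x ∈ φ.range ⊔ N := by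
    intro x
    obtain ⟨y, y', hx⟩ := exists_vecMul_add_smul hK x.toAdd
    have : x = Multiplicative.ofAdd (Matrix.vecMul y Ψ) * Multiplicative.ofAdd y' ^ K := by
      refine Multiplicative.toAdd.injective ?_
      rw [hx, toAdd_mul, toAdd_pow, toAdd_ofAdd, toAdd_ofAdd, natCast_zsmul]
    rw [this, map_mul, ← hΨ]
    exact Subgroup.mul_mem_sup ⟨_, rfl⟩ ⟨Multiplicative.ofAdd y', rfl⟩
  refine hv.ext_of_generates (fun k => ?_) h
  obtain ⟨x, hx⟩ := hφ k
  rw [← mul_inv_eq_iff_eq_mul.2 hx]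
  exact mul_mem (Subgroup.mem_sup_left ⟨u k, rfl⟩) (inv_mem (hlat x))

end Deformation

theorem mainTheorem2 {G : Type*} [Group G] [Group.FG G] [Group.IsNilpotent G]
    (B : Blocks) (u : Fin B.m → G) (e : Fin B.m → ℕ) (hu : IsAdaptedPseudoBasis B u e)
    (d : Fin B.n → ℤ) (c : Matrix (Fin B.n) (Fin B.n) ℤ)
    (hc : |c.det| = 1)
    (hd : Int.gcd (∏ k, d k) (∏ j, (e (B.tor j) : ℤ)) = 1)
    {H : Type*} [Group H] (v : Fin B.m → H) (hv : IsAbelianDeformation B u e d c v) :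
    groupLanguage.ElementarilyEquivalent G H := by
  let z : Fin B.n → Subgroup.center G := fun l => ⟨u (B.add l), hu.add_mem_center l⟩
  let z' : Fin B.n → Subgroup.center H := fun l =>
    ⟨v (B.add l), hv.mem_center hu.toIsPseudoBasis _ (hu.add_mem_center l)⟩
  have he := hu.period_add_eq_zero
  have hext : ∀ x : Multiplicative (Fin B.n → ℤ),
      (∀ l, Function.extend B.add x.toAdd 0 (B.add l) = 0) → x = 1 := fun x hx =>
    Multiplicative.toAdd.injective (funext fun l => by
      rw [← B.add_injective.extend_apply x.toAdd 0 l, hx l]; rfl)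
  refine elementarilyEquivalent_of_homs (V := Multiplicative (Fin B.n → ℤ)) ?_
    (centralZpowHom z) (centralZpowHom_comm z) (fun x hx => hext x fun l => ?_)
    (centralZpowHom z') (centralZpowHom_comm z')
    ((injective_iff_map_eq_one _).2 fun x hx => hext x fun l => ?_) fun K hK => ?_
  · intro M hM x hx
    refine Multiplicative.toAdd.injective ?_
    have : M • x.toAdd = 0 := congrArg Multiplicative.toAdd hx
    exact (smul_eq_zero.1 this).resolve_left hM
  · exact hu.coord_eq_zero (isCoord_centralZpowHom z B.add_injective (fun _ => rfl) he x.toAdd)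
      (hu.commutator_le_tail hx) _ (B.add_lt l)
  · have h := isCoord_centralZpowHom z' B.add_injective (u := v) (fun _ => rfl) he x.toAdd
    rw [ofAdd_toAdd, hx] at h
    exact congrFun (hv.pseudoBasis.coord_unique h (IsPseudoBasis.isCoord_one v e)) _
  · have hE : ∏ j, e (B.tor j) ≠ 0 := Finset.prod_ne_zero_iff.2 fun j _ =>
      (zero_lt_one.trans (hu.period_tor j)).ne'
    have hdE : ∀ l, IsCoprime (d l) ((∏ j, e (B.tor j) : ℕ) : ℤ) := by
      intro l
      rw [Nat.cast_prod]
      exact IsCoprime.of_isCoprime_of_dvd_left (Int.isCoprime_iff_gcd_eq_one.2 hd)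
        (Finset.dvd_prod_of_mem d (Finset.mem_univ l))
    choose d' hd' hK' using fun l => exists_dvd_sub_isCoprime hE hK (hdE l)
    obtain ⟨φ, hφ, hφ'⟩ := hv.exists_hom hu z' (fun _ => rfl) d' fun j l =>
      (Int.natCast_dvd_natCast.2 (Finset.dvd_prod_of_mem _ (Finset.mem_univ j))).trans (hd' l)
    have hdet := isCoprime_det_mul_diagonal hc hK'
    have hΨ := map_centralZpowHom z z' φ _ hφ'
    refine ⟨φ, (Matrix.vecMulLinear (c * Matrix.diagonal d')).toAddMonoidHom.toMultiplicative,
      fun x => hΨ x.toAdd, ?_, exists_eq_map_mul_pow hv.pseudoBasis z z' hφ hΨ hdet, ?_⟩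
    · exact exists_eq_centralZpowHom_of_map_eq hu.toIsPseudoBasis hv.pseudoBasis he z
        (fun _ => rfl) z' (fun _ => rfl) hφ
    · intro M hMK x y hxy
      obtain ⟨w, hw⟩ := exists_smul_of_vecMul_eq_smul
        (IsCoprime.of_isCoprime_of_dvd_right hdet (Int.natCast_dvd_natCast.2 hMK))
        (x := x.toAdd) (y := y.toAdd)
        ((congrArg Multiplicative.toAdd hxy).trans (natCast_zsmul _ _).symm)
      exact ⟨Multiplicative.ofAdd w, Multiplicative.toAdd.injective
        ((natCast_zsmul w M).symm.trans hw.symm)⟩
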